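/- Let $d\ge 3$ and $r\ge 2$ be integers and let $m$ be a product of $r$ distinct primes. A $\mathrm{MOD}_m$ circuit is a finite acyclic circuit over $n$ Boolean inputs in which every gate has unbounded fan-in (parallel wires are allowed) and outputs $1$ if the sum of its inputs is divisible by $m$, and $0$ otherwise. Its depth is the largest number of gates on a directed path, and its size is the number of gates plus the number of wires. A function $f:\{0,1\}^n\to\{0,1\}$ is symmetric if $f(x)$ depends only on the number of ones in $x$. Then there is a function $s:\mathbb{N}\to\mathbb{R}$, depending only on $d$ and $m$, with $s(n)=\tilde O\big(n^{1/(r+d-3)}\big)$ such that for every $n$, every symmetric function $f:\{0,1\}^n\to\{0,1\}$ is computed by a $\mathrm{MOD}_m$ circuit of depth at most $d$ and size at most $\exp(s(n))$. Here $s=\tilde O(g)$ means that $s(n)=O\big(g(n)\,(\log g(n))^{k}\big)$ as $n\to\infty$ for some constant $k$. -/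

import Mathlib

/-- A circuit on `n` Boolean inputs all of whose gates are (unbounded fan-in) `MOD_m` gates:
a finite acyclic directed multigraph of gates with a designated output gate. Parallel wires are
allowed and count separately. There are no constant inputs, but a gate of fan-in `0` is allowed
(by `ModCircuit.eval` it outputs `1`). -/
structure ModCircuit (m n : ℕ) where
  /-- The gates. -/
  Gate : Type
  /-- There are finitely many gates. -/
  fintypeGate : Fintype Gate
  /-- `inputWires g i` is the number of wires from the input variable `x_i` into the gate `g`. -/
  inputWires : Gate → Fin n → ℕ
  /-- `gateWires g h` is the number of wires from the gate `h` into the gate `g`. -/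
  gateWires : Gate → Gate → ℕ
  /-- There are no directed cycles. -/
  acyclic : WellFounded fun h g : Gate => gateWires g h ≠ 0
  /-- The output gate. -/
  output : Gate

namespace ModCircuit

attribute [instance] ModCircuit.fintypeGate

variable {m n : ℕ}

/-- The value of a gate on the input `x`: it is `1` exactly when the sum of the values carried by
its incoming wires is divisible by `m`. -/
def eval (C : ModCircuit m n) (x : Fin n → Bool) : C.Gate → Bool :=
  C.acyclic.fix fun g val =>
    decide (m ∣ (∑ i, C.inputWires g i * (x i).toNat) +
      ∑ h, if w : C.gateWires g h ≠ 0 then C.gateWires g h * (val h w).toNat else 0)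

theorem eval_eq (C : ModCircuit m n) (x : Fin n → Bool) (g : C.Gate) :
    C.eval x g = decide (m ∣ (∑ i, C.inputWires g i * (x i).toNat) +
      ∑ h, C.gateWires g h * (C.eval x h).toNat) := by
  have hs : (∑ h, if _w : C.gateWires g h ≠ 0 then
      C.gateWires g h * (C.eval x h).toNat else 0) =
      ∑ h, C.gateWires g h * (C.eval x h).toNat := by
    refine Finset.sum_congr rfl fun h _ => ?_
    by_cases w : C.gateWires g h = 0 <;> simp [w]
  rw [← hs]
  conv_lhs => rw [eval, WellFounded.fix_eq]
  rfl

/-- The circuit computes the Boolean function `f`. -/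
def Computes (C : ModCircuit m n) (f : (Fin n → Bool) → Bool) : Prop :=
  ∀ x, C.eval x C.output = f x

/-- The depth of a gate: the largest number of gates on a directed path ending in it. -/
def gateDepth (C : ModCircuit m n) : C.Gate → ℕ :=
  C.acyclic.fix fun g dep =>
    (Finset.univ.sup fun h => if w : C.gateWires g h ≠ 0 then dep h w else 0) + 1

theorem gateDepth_eq (C : ModCircuit m n) (g : C.Gate) :
    C.gateDepth g =
      (Finset.univ.sup fun h => if C.gateWires g h ≠ 0 then C.gateDepth h else 0) + 1 := by
  conv_lhs => rw [gateDepth, WellFounded.fix_eq]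
  rfl

/-- The depth of a circuit: the largest number of gates on a directed path. -/
def depth (C : ModCircuit m n) : ℕ :=
  Finset.univ.sup C.gateDepth

/-- The size of a circuit: the number of gates plus the number of wires. -/
def size (C : ModCircuit m n) : ℕ :=
  Fintype.card C.Gate + (∑ g, ∑ i, C.inputWires g i) + ∑ g, ∑ h, C.gateWires g h

end ModCircuit

/-- A Boolean function is symmetric if its value depends only on the number of ones in its
input. -/
def IsSymmetricFunction {n : ℕ} (f : (Fin n → Bool) → Bool) : Prop :=
  ∀ x y : Fin n → Bool, (∑ i, (x i).toNat) = (∑ i, (y i).toNat) → f x = f y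

/-- `f = Õ(g)`: `f = O(g · (log g)^k)` for some constant `k`. -/
def IsSoftO (f g : ℕ → ℝ) : Prop :=
  ∃ k : ℕ, Asymptotics.IsBigO Filter.atTop f fun n => g n * (Real.log (g n)) ^ k

/-! A symmetric function depends only on the number of zeros of the input, so it suffices to
evaluate functions of this count. `LinRep` records the functions that are, modulo a prime `p ∣ m`,
combinations of circuits of a given depth; one more gate tests such a combination for zero, and can
even do so for all primes at once (`comp_forall_eq_zero`). For primes `p ≠ q` dividing `m`, a NOR of
`k` functions given modulo `q` is, modulo `p`, a combination of zero tests of the `q ^ k` linear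
forms over `ZMod q` (`exists_indicator_zero_eq_sum`, `LinRep.nor`). This costs one level and changes
the prime.

Fix `t`. A count of at most `t ^ r` is determined by its residues modulo prime powers in `(t, m *
t]`, one for each prime factor of `m`. Modulo `q`, functions of the residue modulo `q ^ e` are
combinations of binomial coefficients of the count, hence of NORs of fewer than `q ^ e` inputs; a
gate on top gives a depth-two test for the exact count (`comp_zeros_eq`). A block of `t ^ (r + k +
1)` inputs splits into `t` blocks of `t ^ (r + k)`. Summing over the `(n + 1) ^ t` guesses for their
counts, with a NOR checking each guess, adds one level (`exists_linRep_zeros`). An output gate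
brings the depth to `k + 3 = d`. The size is `(n + 2) ^ O(t)`, and `t` of order `n ^ (1 / (r + d -
3))` suffices. -/

namespace ModCircuit

/-! ### Joining circuits under a common output gate -/

open Classical in
/-- The circuit whose output gate reads the inputs with multiplicities `u` and the outputs of the
circuits `C i` with multiplicities `c i`. -/
noncomputable def join {m n : ℕ} {ι : Type} [Fintype ι] (C : ι → ModCircuit m n) (u : Fin n → ℕ)
    (c : ι → ℕ) : ModCircuit m n where
  Gate := Option (Σ i, (C i).Gate)
  fintypeGate := inferInstance
  inputWires g := g.elim u fun a => (C a.1).inputWires a.2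
  gateWires g h := match g, h with
    | _, none => 0
    | none, some b => if b.2 = (C b.1).output then c b.1 else 0
    | some a, some b => if e : b.1 = a.1 then (C a.1).gateWires a.2 (e ▸ b.2) else 0
  acyclic := by
    -- A gate of `C i` is fed only by gates of the same `C i`, and the new output gate feeds
    -- nothing.
    have key : ∀ i (g : (C i).Gate), Acc (fun h g : Option (Σ i, (C i).Gate) =>
        (match g, h with
          | _, none => 0
          | none, some b => if b.2 = (C b.1).output then c b.1 else 0
          | some a, some b =>
            if e : b.1 = a.1 then (C a.1).gateWires a.2 (e ▸ b.2) else 0) ≠ 0)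
        (some ⟨i, g⟩) := by
      intro i g
      induction g using (C i).acyclic.induction with
      | _ g ih =>
        refine Acc.intro _ fun h hh => ?_
        rcases h with _ | ⟨j, h⟩
        · simp at hh
        · by_cases e : j = i
          · subst e
            exact ih h (by simpa using hh)
          · simp [e] at hh
    refine ⟨fun g => ?_⟩
    rcases g with _ | ⟨i, g⟩
    · refine Acc.intro _ fun h hh => ?_
      rcases h with _ | ⟨j, h⟩
      · simp at hh
      · exact key j h
    · exact key i g
  output := none

section join

variable {m n : ℕ} {ι : Type} [Fintype ι] (C : ι → ModCircuit m n) (u : Fin n → ℕ) (c : ι → ℕ)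

/-- The output gate of `join C u c`. -/
def joinOut : (join C u c).Gate := (none : Option (Σ i, (C i).Gate))

/-- The gate `g` of the circuit `C i`, as a gate of `join C u c`. -/
def joinGate (i : ι) (g : (C i).Gate) : (join C u c).Gate :=
  (some ⟨i, g⟩ : Option (Σ i, (C i).Gate))

variable {C u c}

theorem join_gate_cases (g : (join C u c).Gate) :
    g = joinOut C u c ∨ ∃ i h, g = joinGate C u c i h := by
  change Option (Σ i, (C i).Gate) at g
  rcases g with _ | ⟨i, h⟩
  · exact .inl rfl
  · exact .inr ⟨i, h, rfl⟩

variable (C u c)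

theorem join_inputWires_out : (join C u c).inputWires (joinOut C u c) = u := rfl

theorem join_inputWires_gate (i : ι) (g : (C i).Gate) :
    (join C u c).inputWires (joinGate C u c i g) = (C i).inputWires g := rfl

theorem join_gateWires_out (g : (join C u c).Gate) :
    (join C u c).gateWires g (joinOut C u c) = 0 := by
  obtain rfl | ⟨i, g, rfl⟩ := join_gate_cases g <;> rfl

open Classical in
theorem join_gateWires_output (i : ι) (g : (C i).Gate) :
    (join C u c).gateWires (joinOut C u c) (joinGate C u c i g) =
      if g = (C i).output then c i else 0 := rfl

theorem join_gateWires_same (i : ι) (g h : (C i).Gate) :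
    (join C u c).gateWires (joinGate C u c i g) (joinGate C u c i h) = (C i).gateWires g h := by
  simp [join, joinGate]

theorem join_gateWires_ne {i j : ι} (hij : j ≠ i) (g : (C i).Gate) (h : (C j).Gate) :
    (join C u c).gateWires (joinGate C u c i g) (joinGate C u c j h) = 0 := by
  simp [join, joinGate, hij]

theorem sum_join_gate {M : Type*} [AddCommMonoid M] (F : (join C u c).Gate → M) :
    ∑ g, F g = F (joinOut C u c) + ∑ i, ∑ g : (C i).Gate, F (joinGate C u c i g) := by
  have h : ∑ a : Σ i, (C i).Gate, F (joinGate C u c a.1 a.2) =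
      ∑ i, ∑ g : (C i).Gate, F (joinGate C u c i g) := Fintype.sum_sigma _
  rw [← h]
  exact Fintype.sum_option (α := Σ i, (C i).Gate) F

theorem join_eval_gate (x : Fin n → Bool) (i : ι) (g : (C i).Gate) :
    (join C u c).eval x (joinGate C u c i g) = (C i).eval x g := by
  induction g using (C i).acyclic.induction with
  | _ g ih =>
    rw [eval_eq, eval_eq, sum_join_gate, join_gateWires_out, join_inputWires_gate,
      Finset.sum_eq_single i]
    · simp only [zero_mul, zero_add, join_gateWires_same]
      have : ∑ h, (C i).gateWires g h * ((join C u c).eval x (joinGate C u c i h)).toNat =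
          ∑ h, (C i).gateWires g h * ((C i).eval x h).toNat := by
        refine Finset.sum_congr rfl fun h _ => ?_
        by_cases w : (C i).gateWires g h = 0
        · simp [w]
        · rw [ih h w]
      rw [this]
    · intro j _ hj
      simp [join_gateWires_ne C u c hj]
    · simp

theorem join_eval_output (x : Fin n → Bool) :
    (join C u c).eval x (join C u c).output = decide (m ∣ (∑ i, u i * (x i).toNat) +
      ∑ i, c i * ((C i).eval x (C i).output).toNat) := by
  change (join C u c).eval x (joinOut C u c) = _
  rw [eval_eq, sum_join_gate, join_gateWires_out, join_inputWires_out]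
  classical
  simp [join_gateWires_output, join_eval_gate]

theorem join_gateDepth_gate (i : ι) (g : (C i).Gate) :
    (join C u c).gateDepth (joinGate C u c i g) ≤ (C i).gateDepth g := by
  induction g using (C i).acyclic.induction with
  | _ g ih =>
    rw [gateDepth_eq, gateDepth_eq]
    refine Nat.add_le_add_right (Finset.sup_le fun h _ => ?_) 1
    obtain rfl | ⟨j, h, rfl⟩ := join_gate_cases h
    · simp [join_gateWires_out]
    · by_cases e : j = i
      · subst e
        rw [join_gateWires_same]
        by_cases w : (C j).gateWires g h = 0
        · simp [w]
        · simp only [ne_eq, w, not_false_eq_true, if_true]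
          refine (ih h w).trans ?_
          have := Finset.le_sup (f := fun h => if (C j).gateWires g h ≠ 0 then
            (C j).gateDepth h else 0) (Finset.mem_univ h)
          simpa [w] using this
      · simp [join_gateWires_ne C u c e]

theorem join_depth {D : ℕ} (hD : ∀ i, (C i).depth ≤ D) : (join C u c).depth ≤ D + 1 := by
  have key : ∀ i (g : (C i).Gate), (join C u c).gateDepth (joinGate C u c i g) ≤ D := fun i g =>
    (join_gateDepth_gate C u c i g).trans
      ((Finset.le_sup (f := (C i).gateDepth) (Finset.mem_univ g)).trans (hD i))
  refine Finset.sup_le fun g _ => ?_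
  obtain rfl | ⟨i, g, rfl⟩ := join_gate_cases g
  · rw [gateDepth_eq]
    refine Nat.add_le_add_right (Finset.sup_le fun h _ => ?_) 1
    obtain rfl | ⟨j, h, rfl⟩ := join_gate_cases h
    · simp [join_gateWires_out]
    · split_ifs
      · exact key j h
      · simp
  · exact (key i g).trans (Nat.le_succ D)

theorem join_size : (join C u c).size = 1 + ∑ i, u i + ∑ i, (c i + (C i).size) := by
  have hcard : Fintype.card (join C u c).Gate = 1 + ∑ i, Fintype.card (C i).Gate := by
    have : Fintype.card (join C u c).Gate = Fintype.card (Option (Σ i, (C i).Gate)) :=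
      Fintype.card_congr (Equiv.refl _)
    rw [this, Fintype.card_option, Fintype.card_sigma, add_comm]
  have hin : ∀ i (g : (C i).Gate), ∑ h, (join C u c).gateWires (joinGate C u c i g) h =
      ∑ h, (C i).gateWires g h := by
    intro i g
    rw [sum_join_gate, join_gateWires_out, Finset.sum_eq_single i]
    · simp [join_gateWires_same]
    · intro j _ hj
      simp [join_gateWires_ne C u c hj]
    · simp
  have hout : ∑ h, (join C u c).gateWires (joinOut C u c) h = ∑ i, c i := by
    rw [sum_join_gate, join_gateWires_out]
    classical
    simp [join_gateWires_output]
  simp only [size]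
  rw [hcard, sum_join_gate, sum_join_gate, hout]
  simp only [hin, join_inputWires_out, join_inputWires_gate, Finset.sum_add_distrib]
  ring

end join

/-! ### Combinations of circuits, over ℕ and modulo a prime -/

/-- `g` is computed by a circuit of depth at most `D` and size at most `S`. -/
def Comp (m n D S : ℕ) (g : (Fin n → Bool) → Bool) : Prop :=
  ∃ C : ModCircuit m n, C.depth ≤ D ∧ C.Computes g ∧ C.size ≤ S

/-- `N` is a combination of inputs and circuits of depth at most `D`, where the multiplicities and
the sizes of the circuits add up to at most `S`. -/
def NatRep (m n D S : ℕ) (N : (Fin n → Bool) → ℕ) : Prop :=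
  ∃ (ι : Type) (_ : Fintype ι) (C : ι → ModCircuit m n) (u : Fin n → ℕ) (c : ι → ℕ),
    (∀ i, (C i).depth ≤ D) ∧
    (∀ x, N x = ∑ i, u i * (x i).toNat + ∑ i, c i * ((C i).eval x (C i).output).toNat) ∧
    ∑ i, u i + ∑ i, (c i + (C i).size) ≤ S

/-- `F` is congruent modulo `p` to a combination of inputs and circuits of depth at most `D`, where
the multiplicities and the sizes of the circuits add up to at most `S`. -/
def LinRep (m n p D S : ℕ) (F : (Fin n → Bool) → ZMod p) : Prop :=
  ∃ N, NatRep m n D S N ∧ ∀ x, F x = N x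

variable {m n p D S : ℕ}

theorem NatRep.mono {D' S' : ℕ} {N : (Fin n → Bool) → ℕ} (h : NatRep m n D S N)
    (hD : D ≤ D') (hS : S ≤ S') : NatRep m n D' S' N := by
  obtain ⟨ι, _, C, u, c, h1, h2, h3⟩ := h
  exact ⟨ι, _, C, u, c, fun i => (h1 i).trans hD, h2, h3.trans hS⟩

theorem NatRep.zero : NatRep m n D S fun _ => 0 :=
  ⟨Empty, inferInstance, nofun, fun _ => 0, nofun, nofun, by simp, by simp⟩

theorem NatRep.add {S' : ℕ} {N N' : (Fin n → Bool) → ℕ} (hN : NatRep m n D S N)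
    (hN' : NatRep m n D S' N') : NatRep m n D (S + S') fun x => N x + N' x := by
  obtain ⟨ι, _, C, u, c, h1, h2, h3⟩ := hN
  obtain ⟨κ, _, C', u', c', h1', h2', h3'⟩ := hN'
  refine ⟨ι ⊕ κ, inferInstance, Sum.elim C C', u + u', Sum.elim c c', ?_, ?_, ?_⟩
  · rintro (i | i)
    · exact h1 i
    · exact h1' i
  · intro x
    simp only [h2, h2', Pi.add_apply, add_mul, Finset.sum_add_distrib, Fintype.sum_sum_type,
      Sum.elim_inl, Sum.elim_inr]
    ring
  · simp only [Pi.add_apply, Finset.sum_add_distrib, Fintype.sum_sum_type, Sum.elim_inl,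
      Sum.elim_inr] at h3 h3' ⊢
    linarith

theorem NatRep.sum {κ : Type*} (s : Finset κ) {N : κ → (Fin n → Bool) → ℕ}
    (h : ∀ k ∈ s, NatRep m n D S (N k)) :
    NatRep m n D (s.card * S) fun x => ∑ k ∈ s, N k x := by
  classical
  induction s using Finset.induction with
  | empty => simpa using NatRep.zero
  | insert a s ha ih =>
    have := (h a (by simp)).add (ih fun k hk => h k (by simp [hk]))
    simp only [Finset.sum_insert ha, Finset.card_insert_of_notMem ha]
    exact this.mono le_rfl (le_of_eq (by ring))

/-- Only multiplicities are scaled; the circuits are kept even if `a = 0`, so the factor in the size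
is a positive bound `b` rather than `a`. -/
theorem NatRep.natMul {N : (Fin n → Bool) → ℕ} (hN : NatRep m n D S N) {a b : ℕ}
    (hab : a ≤ b) (hb : 0 < b) : NatRep m n D (b * S) fun x => a * N x := by
  obtain ⟨ι, _, C, u, c, h1, h2, h3⟩ := hN
  refine ⟨ι, inferInstance, C, fun i => a * u i, fun i => a * c i, h1, fun x => ?_, ?_⟩
  · simp only [h2, mul_add, Finset.mul_sum, mul_assoc]
  · refine le_trans ?_ (Nat.mul_le_mul_left b h3)
    rw [mul_add, Finset.mul_sum, Finset.mul_sum]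
    refine add_le_add (Finset.sum_le_sum fun i _ => Nat.mul_le_mul_right _ hab)
      (Finset.sum_le_sum fun i _ => ?_)
    rw [mul_add]
    exact add_le_add (Nat.mul_le_mul_right _ hab) (Nat.le_mul_of_pos_left _ hb)

theorem NatRep.comp_dvd {N : (Fin n → Bool) → ℕ} (hN : NatRep m n D S N) :
    Comp m n (D + 1) (1 + S) fun x => decide (m ∣ N x) := by
  obtain ⟨ι, _, C, u, c, h1, h2, h3⟩ := hN
  refine ⟨join C u c, join_depth C u c h1, fun x => ?_, ?_⟩
  · simp only [join_eval_output, h2]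
  · rw [join_size]
    linarith

theorem LinRep.mono {D' S' : ℕ} {F : (Fin n → Bool) → ZMod p} (h : LinRep m n p D S F)
    (hD : D ≤ D') (hS : S ≤ S') : LinRep m n p D' S' F :=
  let ⟨N, h1, h2⟩ := h
  ⟨N, h1.mono hD hS, h2⟩

theorem LinRep.zero : LinRep m n p D S fun _ => 0 :=
  ⟨_, NatRep.zero, by simp⟩

theorem LinRep.sum {κ : Type*} (s : Finset κ) {F : κ → (Fin n → Bool) → ZMod p}
    (h : ∀ k ∈ s, LinRep m n p D S (F k)) :
    LinRep m n p D (s.card * S) fun x => ∑ k ∈ s, F k x := by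
  choose! N h1 h2 using h
  refine ⟨_, NatRep.sum s h1, fun x => ?_⟩
  rw [Nat.cast_sum]
  exact Finset.sum_congr rfl fun k hk => h2 k hk x

theorem LinRep.constMul [NeZero p] {F : (Fin n → Bool) → ZMod p} (hF : LinRep m n p D S F)
    (a : ZMod p) : LinRep m n p D (p * S) fun x => a * F x := by
  obtain ⟨N, h1, h2⟩ := hF
  exact ⟨_, h1.natMul (ZMod.val_lt a).le (Nat.pos_of_neZero p), fun x => by simp [h2]⟩

theorem LinRep.input (i : Fin n) :
    LinRep m n p D 1 fun x => ((x i).toNat : ZMod p) := by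
  refine ⟨fun x => (x i).toNat,
    ⟨Empty, inferInstance, nofun, Pi.single i 1, nofun, nofun, fun x => ?_, ?_⟩, fun x => rfl⟩
  · simp [Pi.single_apply]
  · simp

theorem Comp.linRep {g : (Fin n → Bool) → Bool} (h : Comp m n D S g) :
    LinRep m n p D (1 + S) fun x => ((g x).toNat : ZMod p) := by
  obtain ⟨C, h1, h2, h3⟩ := h
  refine ⟨fun x => (g x).toNat,
    ⟨Unit, inferInstance, fun _ => C, fun _ => 0, fun _ => 1, fun _ => h1, fun x => ?_, ?_⟩,
    fun x => rfl⟩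
  · simp [h2 x]
  · simpa using h3

/-! ### One gate testing conditions modulo several primes -/

/-- Chinese remaindering: `m / q` is a unit modulo `q` and vanishes modulo the other primes, so
modulo `q` only the term of `q` survives. -/
theorem prod_dvd_sum_iff {P : Finset ℕ} (hP : ∀ q ∈ P, q.Prime) (a : ℕ → ℕ) :
    ∏ q ∈ P, q ∣ ∑ q ∈ P, (∏ q' ∈ P, q') / q * a q ↔ ∀ q ∈ P, q ∣ a q := by
  have hdiv : ∀ q ∈ P, (∏ q' ∈ P, q') / q = ∏ q' ∈ P.erase q, q' := fun q hq => by
    rw [← Finset.mul_prod_erase P (fun q => q) hq, Nat.mul_div_cancel_left _ (hP q hq).pos]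
  have hmod : ∀ q ∈ P, (q ∣ ∑ q' ∈ P, (∏ q'' ∈ P, q'') / q' * a q' ↔ q ∣ a q) := by
    intro q hq
    rw [← Finset.add_sum_erase P _ hq, Nat.dvd_add_left, hdiv q hq]
    · refine ⟨fun h => ?_, fun h => h.mul_left _⟩
      refine Nat.Coprime.dvd_of_dvd_mul_left (Nat.Coprime.prod_right fun q' hq' => ?_) h
      rw [Finset.mem_erase] at hq'
      exact (Nat.coprime_primes (hP q hq) (hP q' hq'.2)).2 hq'.1.symm
    · refine Finset.dvd_sum fun q' hq' => ?_
      rw [Finset.mem_erase] at hq'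
      rw [hdiv q' hq'.2]
      exact (Finset.dvd_prod_of_mem (fun q => q)
        (Finset.mem_erase.2 ⟨hq'.1.symm, hq⟩)).mul_right _
  refine ⟨fun h q hq => (hmod q hq).1 ((Finset.dvd_prod_of_mem (fun q => q) hq).trans h),
    fun h => ?_⟩
  exact Finset.prod_primes_dvd _ (fun q hq => (hP q hq).prime) fun q hq => (hmod q hq).2 (h q hq)

theorem comp_forall_eq_zero {P : Finset ℕ} (hP : ∀ q ∈ P, q.Prime) (hm : m = ∏ q ∈ P, q)
    {F : (q : ℕ) → (Fin n → Bool) → ZMod q} (hF : ∀ q ∈ P, LinRep m n q D S (F q)) :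
    Comp m n (D + 1) (1 + P.card * (m * S)) fun x => decide (∀ q ∈ P, F q x = 0) := by
  have hm0 : 0 < m := hm ▸ Finset.prod_pos fun q hq => (hP q hq).pos
  choose! N h1 h2 using hF
  have h := (NatRep.sum P fun q hq =>
    (h1 q hq).natMul (Nat.div_le_self m q) hm0).comp_dvd
  convert h using 3 with x
  rw [hm, prod_dvd_sum_iff hP fun q => N q x]
  exact forall₂_congr fun q hq => by rw [h2 q hq, ZMod.natCast_eq_zero_iff]

theorem LinRep.comp_eq_zero {P : Finset ℕ} (hP : ∀ q ∈ P, q.Prime) (hm : m = ∏ q ∈ P, q)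
    (hp : p ∈ P) {F : (Fin n → Bool) → ZMod p} (hF : LinRep m n p D S F) :
    Comp m n (D + 1) (1 + P.card * (m * S)) fun x => decide (F x = 0) := by
  have h := comp_forall_eq_zero (D := D) (S := S) (n := n) hP hm
    -- The zero function at the other primes makes their conditions vacuous.
    (F := Function.update (fun _ _ => 0) p F) fun q hq => by
      obtain rfl | hqp := eq_or_ne q p
      · simpa using hF
      · simpa [hqp] using LinRep.zero
  convert h using 3 with x
  refine ⟨fun h q hq => ?_, fun h => by simpa using h p hp⟩
  obtain rfl | hqp := eq_or_ne q p
  · simpa using h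
  · simp [hqp]

end ModCircuit

/-! ### Indicators and linear forms over a finite field -/

open Finset in
-- The fibres of a nonzero linear form are translates of one another, so they have equal size. The
-- factor `q` avoids the exponent `k - 1`.
theorem sum_ite_dotProduct_eq {R : Type*} [CommRing R] {q : ℕ} [Fact q.Prime] {k : ℕ}
    {v : Fin k → ZMod q} (hv : v ≠ 0) (b : ZMod q) :
    (q : R) * ∑ a : Fin k → ZMod q, (if a ⬝ᵥ v = b then 1 else 0) = (q : R) ^ k := by
  obtain ⟨i, hi⟩ := Function.ne_iff.1 hv
  have hi' : v i ≠ 0 := hi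
  have shift : ∀ b' : ZMod q, ∑ a : Fin k → ZMod q, (if a ⬝ᵥ v = b' then (1 : R) else 0) =
      ∑ a : Fin k → ZMod q, (if a ⬝ᵥ v = b then 1 else 0) := by
    intro b'
    refine Fintype.sum_equiv (Equiv.addRight (Pi.single i ((b - b') / v i))) _ _ fun a => ?_
    have : (a + Pi.single i ((b - b') / v i)) ⬝ᵥ v = a ⬝ᵥ v + (b - b') := by
      rw [add_dotProduct, single_dotProduct, div_mul_cancel₀ _ hi']
    simp only [Equiv.coe_addRight, this]
    refine if_congr ⟨fun h => by rw [h]; ring, fun h => ?_⟩ rfl rfl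
    linear_combination h
  have total : ∑ b' : ZMod q, ∑ a : Fin k → ZMod q, (if a ⬝ᵥ v = b' then (1 : R) else 0) =
      (q : R) ^ k := by
    rw [sum_comm]
    simp
  rw [← total, sum_congr rfl fun b' _ => shift b']
  simp

/-- Modulo a prime different from `q`, the indicator of `0` on `(ℤ/q)ᵏ` is a linear combination of
the indicators of the kernels of linear forms. -/
theorem exists_indicator_zero_eq_sum {p q : ℕ} [Fact p.Prime] [Fact q.Prime] (hpq : p ≠ q)
    (k : ℕ) : ∃ c : (Fin k → ZMod q) → ZMod p, ∀ y : Fin k → ZMod q,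
      (if y = 0 then 1 else 0 : ZMod p) = ∑ a, c a * if a ⬝ᵥ y = 0 then 1 else 0 := by
  have hq : (q : ZMod p) ≠ 0 := fun h =>
    hpq ((Nat.prime_dvd_prime_iff_eq Fact.out Fact.out).1 ((ZMod.natCast_eq_zero_iff q p).1 h))
  induction k with
  | zero => exact ⟨fun _ => 1, fun y => by simp [Subsingleton.elim y 0]⟩
  | succ k ih =>
    obtain ⟨c, hc⟩ := ih
    suffices h : (fun y : Fin (k + 1) → ZMod q => if y = 0 then (1 : ZMod p) else 0) ∈
        Submodule.span (ZMod p) (Set.range fun (a y : Fin (k + 1) → ZMod q) =>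
          if a ⬝ᵥ y = 0 then (1 : ZMod p) else 0) by
      obtain ⟨c', hc'⟩ := (Submodule.mem_span_range_iff_exists_fun _).1 h
      refine ⟨c', fun y => ?_⟩
      have := congrFun hc' y
      simpa [Finset.sum_apply] using this.symm
    have gen : ∀ a : Fin (k + 1) → ZMod q, (fun y => if a ⬝ᵥ y = 0 then (1 : ZMod p) else 0) ∈
        Submodule.span (ZMod p) (Set.range fun (a y : Fin (k + 1) → ZMod q) =>
          if a ⬝ᵥ y = 0 then (1 : ZMod p) else 0) := fun a => Submodule.subset_span ⟨a, rfl⟩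
    -- Write `y = (y0, ys)`. The average over `a` of the tests `y0 + a ⬝ᵥ ys = 0` is `[y0 = 0]` if
    -- `ys = 0`, and `1 / q` otherwise. Adding `([ys = 0] - 1) / q` corrects the second case and
    -- leaves the first; the constant is the test of the zero form, and `[ys = 0]` comes from
    -- induction.
    have key : (fun y : Fin (k + 1) → ZMod q => if y = 0 then (1 : ZMod p) else 0) =
        ((q : ZMod p) ^ k)⁻¹ • ∑ a : Fin k → ZMod q, (fun y : Fin (k + 1) → ZMod q =>
            if Matrix.vecCons 1 a ⬝ᵥ y = 0 then (1 : ZMod p) else 0) +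
        (-(q : ZMod p)⁻¹) • (fun y : Fin (k + 1) → ZMod q =>
            if (0 : Fin (k + 1) → ZMod q) ⬝ᵥ y = 0 then (1 : ZMod p) else 0) +
        (q : ZMod p)⁻¹ • ∑ a : Fin k → ZMod q, c a • (fun y : Fin (k + 1) → ZMod q =>
            if Matrix.vecCons 0 a ⬝ᵥ y = 0 then (1 : ZMod p) else 0) := by
      funext y
      obtain ⟨y0, ys, rfl⟩ : ∃ y0 ys, y = Matrix.vecCons y0 ys :=
        ⟨Matrix.vecHead y, Matrix.vecTail y, (Matrix.cons_head_tail y).symm⟩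
      have hcons : Matrix.vecCons y0 ys = 0 ↔ y0 = 0 ∧ ys = 0 := by
        rw [← Matrix.cons_zero_zero]
        exact Matrix.vecCons_inj
      simp only [Pi.add_apply, Pi.smul_apply, Finset.sum_apply, Matrix.cons_dotProduct_cons,
        smul_eq_mul, zero_mul, zero_add, one_mul, zero_dotProduct, if_true, hcons, ← hc]
      by_cases hys : ys = 0
      · subst hys
        by_cases h0 : y0 = 0
        · simp [h0, hq]
        · simp [h0]
      · have h1 := sum_ite_dotProduct_eq (R := ZMod p) hys (-y0)
        have h2 : ∀ a : Fin k → ZMod q, (y0 + a ⬝ᵥ ys = 0) ↔ a ⬝ᵥ ys = -y0 := fun a =>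
          add_comm y0 _ ▸ add_eq_zero_iff_eq_neg
        simp only [h2, hys, and_false, if_false]
        field_simp
        linear_combination -h1
    rw [key]
    refine add_mem (add_mem (Submodule.smul_mem _ _ (sum_mem fun a _ => gen _))
      (Submodule.smul_mem _ _ (gen _))) (Submodule.smul_mem _ _
        (sum_mem fun a _ => Submodule.smul_mem _ _ (gen _)))

/-! ### Binomial coefficients modulo a prime -/

theorem exists_eq_sum_choose {R : Type*} [CommRing R] (h : ℕ → R) (N : ℕ) :
    ∃ c : ℕ → R, ∀ w < N, h w = ∑ j ∈ Finset.range N, c j * (w.choose j : R) := by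
  induction N with
  | zero => exact ⟨0, by simp⟩
  | succ N ih =>
    obtain ⟨c, hc⟩ := ih
    -- Newton interpolation: `w.choose N` is `0` for `w < N` and `1` at `N`, so no division is
    -- needed.
    refine ⟨Function.update c N (h N - ∑ j ∈ Finset.range N, c j * (N.choose j : R)),
      fun w hw => ?_⟩
    have hsum : ∑ j ∈ Finset.range N, Function.update c N
        (h N - ∑ j ∈ Finset.range N, c j * (N.choose j : R)) j * (w.choose j : R) =
        ∑ j ∈ Finset.range N, c j * (w.choose j : R) := by
      refine Finset.sum_congr rfl fun j hj => ?_
      rw [Function.update_of_ne (Finset.mem_range.1 hj).ne]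
    rw [Finset.sum_range_succ, hsum, Function.update_self]
    obtain hw' | rfl := Nat.lt_succ_iff_lt_or_eq.1 hw
    · simp [Nat.choose_eq_zero_of_lt hw', hc w hw']
    · simp

/-- In Vandermonde's identity, `p` divides `(p ^ e).choose b` for `0 < b < p ^ e`, leaving only the
term `b = 0`. -/
theorem cast_choose_add_prime_pow {p : ℕ} [Fact p.Prime] {e j : ℕ} (hj : j < p ^ e) (w : ℕ) :
    ((w + p ^ e).choose j : ZMod p) = (w.choose j : ZMod p) := by
  rw [Nat.add_choose_eq, Nat.cast_sum, Finset.sum_eq_single (j, 0)]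
  · simp
  · rintro ⟨a, b⟩ hab hne
    rw [Finset.HasAntidiagonal.mem_antidiagonal] at hab
    have hb : b ≠ 0 := fun hb => hne (by subst hb; simpa using hab)
    have : (((p ^ e).choose b : ℕ) : ZMod p) = 0 := (ZMod.natCast_eq_zero_iff _ _).2
      ((Fact.out : p.Prime).dvd_choose_pow hb (by simp at hab; omega))
    simp [this]
  · simp

theorem cast_choose_mod_prime_pow {p : ℕ} [Fact p.Prime] {e j : ℕ} (hj : j < p ^ e) (w : ℕ) :
    ((w % p ^ e).choose j : ZMod p) = (w.choose j : ZMod p) := by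
  have : ∀ t a, ((a + p ^ e * t).choose j : ZMod p) = (a.choose j : ZMod p) := by
    intro t a
    induction t with
    | zero => simp
    | succ t ih => rw [Nat.mul_succ, ← add_assoc, cast_choose_add_prime_pow hj, ih]
  conv_rhs => rw [← Nat.mod_add_div w (p ^ e), this]

theorem exists_mod_prime_pow_eq_sum_choose {p : ℕ} [Fact p.Prime] (e : ℕ) (h : ℕ → ZMod p) :
    ∃ c : ℕ → ZMod p, ∀ w, h (w % p ^ e) =
      ∑ j ∈ Finset.range (p ^ e), c j * (w.choose j : ZMod p) := by
  obtain ⟨c, hc⟩ := exists_eq_sum_choose h (p ^ e)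
  refine ⟨c, fun w => ?_⟩
  rw [hc _ (Nat.mod_lt _ (pow_pos (Fact.out : p.Prime).pos e))]
  exact Finset.sum_congr rfl fun j hj => by
    rw [cast_choose_mod_prime_pow (Finset.mem_range.1 hj)]

/-! ### Counting zeros in blocks -/

/-- The number of zeros of `x` in the block `B`. -/
def zeros {n : ℕ} (B : Finset (Fin n)) (x : Fin n → Bool) : ℕ :=
  ∑ i ∈ B, if x i = false then 1 else 0

theorem zeros_eq_card {n : ℕ} (B : Finset (Fin n)) (x : Fin n → Bool) :
    zeros B x = (B.filter fun i => x i = false).card := by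
  rw [zeros, Finset.card_filter]

theorem zeros_le_card {n : ℕ} (B : Finset (Fin n)) (x : Fin n → Bool) : zeros B x ≤ B.card :=
  zeros_eq_card B x ▸ Finset.card_filter_le _ _

theorem sum_toNat_add_zeros {n : ℕ} (x : Fin n → Bool) :
    ∑ i, (x i).toNat + zeros Finset.univ x = n := by
  rw [zeros, ← Finset.sum_add_distrib]
  have : ∀ i, (x i).toNat + (if x i = false then 1 else 0) = 1 := fun i => by
    cases x i <;> rfl
  simp [this]

open Finset in
-- Both sides count the `j`-subsets of `B` on which `x` vanishes. Counting zeros rather than ones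
-- makes each summand a NOR of inputs.
theorem cast_choose_zeros {R : Type*} [CommRing R] {n : ℕ} (B : Finset (Fin n)) (j : ℕ)
    (x : Fin n → Bool) : ((zeros B x).choose j : R) =
      ∑ A ∈ B.powersetCard j, if ∀ i ∈ A, x i = false then 1 else 0 := by
  rw [zeros_eq_card, ← card_powersetCard, ← Finset.sum_filter, Finset.sum_const, nsmul_eq_mul,
    mul_one]
  congr 2
  ext A
  simp only [mem_powersetCard, mem_filter, subset_iff]
  grind

/-- A set of at most `t * s` elements is the union of `t` blocks of at most `s` elements. -/
theorem exists_blocks {α : Type*} [DecidableEq α] (t s : ℕ) (B : Finset α)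
    (hB : B.card ≤ t * s) : ∃ A : Fin t → Finset α, (∀ j, (A j).card ≤ s) ∧
      ∀ F : α → ℕ, ∑ i ∈ B, F i = ∑ j, ∑ i ∈ A j, F i := by
  induction t generalizing B with
  | zero =>
    have : B = ∅ := by simpa using hB
    exact ⟨nofun, nofun, by simp [this]⟩
  | succ t ih =>
    obtain ⟨A, hAB, hA⟩ := Finset.exists_subset_card_eq (min_le_right s B.card)
    obtain ⟨A', h1, h2⟩ := ih (B \ A) (by
      rw [Finset.card_sdiff_of_subset hAB, hA]
      rw [Nat.succ_mul] at hB
      omega)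
    refine ⟨Fin.cons A A', fun j => ?_, fun F => ?_⟩
    · refine Fin.cases ?_ h1 j
      simp [hA]
    · rw [Fin.sum_univ_succ, ← Finset.sum_sdiff hAB, h2, add_comm]
      simp

/-! ### Size bounds: powers of `(n + 2) ^ t` with exponents independent of `n` and `t` -/

/-- The size of the representation of a conjunction of `k` functions of size `S`. -/
def norSize (R m k S : ℕ) : ℕ := m ^ k * (m * (1 + (1 + R * (m * (k * (m * S))))))

theorem norSize_mono {R m k k' S : ℕ} (hm : 0 < m) (h : k ≤ k') :
    norSize R m k S ≤ norSize R m k' S := by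
  unfold norSize
  gcongr

section bounds

variable {Z a b c R m k S n t : ℕ}

theorem le_pow_self_of_two_le (hZ : 2 ≤ Z) (a : ℕ) : a ≤ Z ^ a :=
  Nat.lt_two_pow_self.le.trans (Nat.pow_le_pow_left hZ a)

theorem mul_le_pow_add (ha : a ≤ Z ^ R) (hb : b ≤ Z ^ c) : a * b ≤ Z ^ (R + c) :=
  pow_add Z R c ▸ Nat.mul_le_mul ha hb

theorem one_add_one_add_le_pow (hZ : 2 ≤ Z) (ha : a ≤ Z ^ c) : 1 + (1 + a) ≤ Z ^ (c + 2) := by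
  have h1 : 1 ≤ Z ^ c := Nat.one_le_pow _ _ (by omega)
  have h2 : 2 * 2 ≤ Z ^ 2 := by rw [pow_two]; exact Nat.mul_le_mul hZ hZ
  calc 1 + (1 + a) ≤ Z ^ c * (2 * 2) := by omega
    _ ≤ Z ^ (c + 2) := by rw [pow_add]; exact Nat.mul_le_mul_left _ h2

theorem two_le_add_two_pow (ht : 1 ≤ t) : 2 ≤ (n + 2) ^ t :=
  le_trans (by omega) (Nat.le_self_pow (by omega) (n + 2))

theorem le_add_two_pow (n t : ℕ) : t ≤ (n + 2) ^ t :=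
  le_pow_self_of_two_le (by omega) t

theorem mul_le_pow_succ (ht : 1 ≤ t) (m : ℕ) : m * t ≤ ((n + 2) ^ t) ^ (m + 1) :=
  mul_le_pow_add (le_pow_self_of_two_le (two_le_add_two_pow ht) m)
    ((le_add_two_pow n t).trans_eq (pow_one _).symm)

/-- The exponent in `norSize_le`. -/
def norExp (R m c : ℕ) : ℕ := m * m + (m + (R + (m + ((m + 1) + (m + c))) + 2))

theorem norSize_le (ht : 1 ≤ t) (hm : 0 < m) (hk : k ≤ m * t) (hS : S ≤ ((n + 2) ^ t) ^ c) :
    norSize R m k S ≤ ((n + 2) ^ t) ^ norExp R m c := by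
  have hZ : 2 ≤ (n + 2) ^ t := two_le_add_two_pow ht
  have hmZ := le_pow_self_of_two_le hZ m
  refine mul_le_pow_add ?_ (mul_le_pow_add hmZ (one_add_one_add_le_pow hZ
    (mul_le_pow_add (le_pow_self_of_two_le hZ R) (mul_le_pow_add hmZ
      (mul_le_pow_add (hk.trans (mul_le_pow_succ ht m)) (mul_le_pow_add hmZ hS))))))
  calc m ^ k ≤ m ^ (m * t) := Nat.pow_le_pow_right hm hk
    _ ≤ ((n + 2) ^ m) ^ (m * t) :=
      Nat.pow_le_pow_left (le_pow_self_of_two_le (by omega) m) _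
    _ = ((n + 2) ^ t) ^ (m * m) := by rw [← pow_mul, ← pow_mul]; ring_nf

end bounds

/-! ### Circuits for NOR, exact counts and symmetric functions -/

namespace ModCircuit

variable {m n p q D S : ℕ} {P : Finset ℕ}

theorem le_of_mem_of_eq_prod (hP : ∀ q ∈ P, q.Prime) (hm : m = ∏ q ∈ P, q) (hp : p ∈ P) :
    p ≤ m := by
  rw [hm]
  exact Nat.le_of_dvd (Finset.prod_pos fun q hq => (hP q hq).pos)
    (Finset.dvd_prod_of_mem (fun q => q) hp)

/-- The NOR is the indicator of `0` at the vector of the `y j` in `(ZMod q) ^ k`. Each linear form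
in the `y j` is again a combination modulo `q`, and its zero test is a single gate whose output can
be summed modulo `p`. -/
theorem LinRep.nor (hP : ∀ q ∈ P, q.Prime) (hm : m = ∏ q ∈ P, q) (hp : p ∈ P) (hq : q ∈ P)
    (hpq : p ≠ q) {k : ℕ} {y : Fin k → (Fin n → Bool) → Bool}
    (hy : ∀ j, LinRep m n q D S fun x => ((y j x).toNat : ZMod q)) :
    LinRep m n p (D + 1) (norSize P.card m k S)
      fun x => if ∀ j, y j x = false then 1 else 0 := by
  have : Fact p.Prime := ⟨hP p hp⟩
  have : Fact q.Prime := ⟨hP q hq⟩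
  obtain ⟨c, hc⟩ := exists_indicator_zero_eq_sum hpq k
  have h := LinRep.sum (Finset.univ : Finset (Fin k → ZMod q)) fun a _ =>
    ((LinRep.comp_eq_zero hP hm hq (LinRep.sum Finset.univ fun j _ =>
      (hy j).constMul (a j))).linRep (p := p)).constMul (c a)
  have hpm := le_of_mem_of_eq_prod hP hm hp
  have hqm := le_of_mem_of_eq_prod hP hm hq
  convert h.mono le_rfl (S' := norSize P.card m k S) ?_ using 2 with x
  · have := hc fun j => ((y j x).toNat : ZMod q)
    have hzero : (fun j => ((y j x).toNat : ZMod q)) = 0 ↔ ∀ j, y j x = false := by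
      rw [funext_iff]
      refine forall_congr' fun j => ?_
      cases y j x <;> simp
    rw [if_congr hzero rfl rfl] at this
    rw [this]
    refine Finset.sum_congr rfl fun a _ => ?_
    congr 1
    simp only [dotProduct]
    split_ifs with h0 <;> simp [h0]
  · unfold norSize
    simp only [Finset.card_univ, Fintype.card_pi, Fintype.card_fin, ZMod.card,
      Finset.prod_const]
    gcongr

/-- Modulo `p`, every function of the number of zeros modulo `p ^ e` is a combination of gates that
read the inputs only. -/
theorem linRep_zeros_mod (hP : ∀ q ∈ P, q.Prime) (hm : m = ∏ q ∈ P, q) (hp : p ∈ P)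
    (hq : q ∈ P) (hpq : p ≠ q) (B : Finset (Fin n)) (e : ℕ) (h : ℕ → ZMod p) :
    LinRep m n p 1 (p ^ e * (p * ((n + 2) ^ p ^ e * norSize P.card m (p ^ e) 1)))
      fun x => h (zeros B x % p ^ e) := by
  have : Fact p.Prime := ⟨hP p hp⟩
  have hm0 : 0 < m := hm ▸ Finset.prod_pos fun q hq => (hP q hq).pos
  obtain ⟨c, hc⟩ := exists_mod_prime_pow_eq_sum_choose e h
  simp only [hc, cast_choose_zeros]
  have key : ∀ j ∈ Finset.range (p ^ e), LinRep m n p 1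
      ((n + 2) ^ p ^ e * norSize P.card m (p ^ e) 1) fun x => ∑ A ∈ B.powersetCard j,
        if ∀ i ∈ A, x i = false then (1 : ZMod p) else 0 := by
    intro j hj
    rw [Finset.mem_range] at hj
    refine (LinRep.sum (S := norSize P.card m (p ^ e) 1) (B.powersetCard j)
      fun A hA => ?_).mono le_rfl (Nat.mul_le_mul_right _ ?_)
    · have hA' := (Finset.mem_powersetCard.1 hA).2
      have := (LinRep.nor (D := 0) (S := 1) hP hm hp hq hpq
        (y := fun i x => x (A.orderEmbOfFin hA' i)) fun i => LinRep.input _).mono le_rfl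
          (norSize_mono hm0 hj.le)
      convert this using 2 with x
      refine if_congr ⟨fun h i => h _ (A.orderEmbOfFin_mem hA' i), fun h i hi => ?_⟩ rfl rfl
      have hi' : i ∈ Set.range (A.orderEmbOfFin hA') := by
        rw [Finset.range_orderEmbOfFin]
        exact hi
      obtain ⟨k, rfl⟩ := hi'
      exact h k
    · rw [Finset.card_powersetCard]
      have hB : B.card ≤ n := (Finset.card_le_univ B).trans_eq (Fintype.card_fin n)
      calc B.card.choose j ≤ B.card ^ j := Nat.choose_le_pow _ _
        _ ≤ (n + 2) ^ j := Nat.pow_le_pow_left (by omega) j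
        _ ≤ (n + 2) ^ p ^ e := Nat.pow_le_pow_right (by omega) hj.le
  simpa using LinRep.sum (Finset.range (p ^ e)) fun j hj => (key j hj).constMul (c j)

theorem eq_of_forall_mod_eq (hP : ∀ q ∈ P, q.Prime) {e : ℕ → ℕ} {a b : ℕ}
    (ha : a < ∏ q ∈ P, q ^ e q) (hb : b < ∏ q ∈ P, q ^ e q)
    (h : ∀ q ∈ P, a % q ^ e q = b % q ^ e q) : a = b := by
  have hdvd : ((∏ q ∈ P, q ^ e q : ℕ) : ℤ) ∣ (b : ℤ) - a := by
    rw [Nat.cast_prod]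
    refine Finset.prod_dvd_of_coprime (fun q hq q' hq' hne => ?_) fun q hq => ?_
    · exact Nat.isCoprime_iff_coprime.2
        (Nat.Coprime.pow _ _ ((Nat.coprime_primes (hP q hq) (hP q' hq')).2 hne))
    · exact (Nat.modEq_iff_dvd (n := q ^ e q)).1 (h q hq)
  have := Int.eq_zero_of_abs_lt_dvd hdvd (by rw [abs_lt]; omega)
  omega

/-- The bound for the size of depth-one combinations that count zeros modulo prime powers. -/
def modSize (R m n t : ℕ) : ℕ :=
  m * t * (m * ((n + 2) ^ (m * t) * norSize R m (m * t) 1))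

/-- The exponent in `modSize_le`. -/
def modExp (R m : ℕ) : ℕ := (m + 1) + (m + (m + norExp R m 0))

theorem modSize_le {R t : ℕ} (ht : 1 ≤ t) (hm : 0 < m) : modSize R m n t ≤ ((n + 2) ^ t) ^ modExp R m :=
  mul_le_pow_add (mul_le_pow_succ ht m) (mul_le_pow_add
    (le_pow_self_of_two_le (two_le_add_two_pow ht) m) (mul_le_pow_add
      (le_of_eq (by rw [← pow_mul, mul_comm])) (norSize_le ht hm le_rfl (by simp))))

theorem comp_zeros_eq (hP : ∀ q ∈ P, q.Prime) (hm : m = ∏ q ∈ P, q) (hcard : 2 ≤ P.card)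
    {t : ℕ} (ht : 1 ≤ t) (B : Finset (Fin n)) (hB : B.card ≤ t ^ P.card) {z : ℕ}
    (hz : z ≤ B.card) :
    Comp m n 2 (1 + P.card * (m * modSize P.card m n t)) fun x => decide (zeros B x = z) := by
  -- The least power of `q` exceeding `t`: large enough for the product to exceed `t ^ P.card`, yet
  -- at most `m * t`.
  let e : ℕ → ℕ := fun q => Nat.log q t + 1
  have hlt : t ^ P.card < ∏ q ∈ P, q ^ e q := by
    rw [← Finset.prod_const]
    have hne : P.Nonempty := Finset.card_pos.1 (by omega)
    exact Finset.prod_lt_prod_of_nonempty (fun _ _ => ht)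
      (fun q hq => Nat.lt_pow_succ_log_self (hP q hq).one_lt t) hne
  have h := comp_forall_eq_zero (m := m) (n := n) (D := 1) (S := modSize P.card m n t) hP hm
    (F := fun q x => if zeros B x % q ^ e q = z % q ^ e q then 0 else 1) fun q hq => by
      obtain ⟨q', hq', hne⟩ := P.exists_mem_ne (by omega) q
      refine (linRep_zeros_mod hP hm hq hq' hne.symm B (e q)
        (fun w => if w = z % q ^ e q then 0 else 1)).mono le_rfl ?_
      have hqm := le_of_mem_of_eq_prod hP hm hq
      have hm0 : 0 < m := (hP q hq).pos.trans_le hqm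
      have hN : q ^ e q ≤ m * t := by
        rw [pow_succ, mul_comm m]
        exact Nat.mul_le_mul (Nat.pow_log_le_self q (by omega)) hqm
      exact Nat.mul_le_mul hN (Nat.mul_le_mul hqm (Nat.mul_le_mul
        (Nat.pow_le_pow_right (by omega) hN) (norSize_mono hm0 hN)))
  convert h using 3 with x
  refine ⟨fun h q hq => by simp [h], fun h => ?_⟩
  refine eq_of_forall_mod_eq hP (e := e) (((zeros_le_card B x).trans hB).trans_lt hlt)
    ((hz.trans hB).trans_lt hlt) fun q hq => ?_
  have : Fact q.Prime := ⟨hP q hq⟩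
  by_contra hne
  simpa [hne] using h q hq

/-- Symmetric functions of blocks of `t ^ (r + k)` inputs, where `r` is the number of prime factors
of `m`, are modulo every prime factor of `m` combinations of circuits of depth `k + 2`. -/
theorem exists_linRep_zeros (hP : ∀ q ∈ P, q.Prime) (hm : m = ∏ q ∈ P, q)
    (hcard : 2 ≤ P.card) (k : ℕ) : ∃ c, ∀ n t : ℕ, 1 ≤ t → ∀ p ∈ P, ∀ B : Finset (Fin n),
      B.card ≤ t ^ (P.card + k) → ∀ f : ℕ → Bool,
        LinRep m n p (k + 2) (((n + 2) ^ t) ^ c)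
          fun x => ((f (zeros B x)).toNat : ZMod p) := by
  have hm0 : 0 < m := hm ▸ Finset.prod_pos fun q hq => (hP q hq).pos
  have card_le : ∀ {n} (B : Finset (Fin n)), B.card ≤ n := fun B =>
    (Finset.card_le_univ B).trans_eq (Fintype.card_fin _)
  induction k with
  | zero =>
    refine ⟨1 + (P.card + (m + modExp P.card m) + 2), fun n t ht p hp B hB f => ?_⟩
    have h := LinRep.sum (p := p) ((Finset.range (B.card + 1)).filter fun z => f z = true)
      fun z hz => (comp_zeros_eq (n := n) (z := z) hP hm hcard ht B hB (by
        rw [Finset.mem_filter, Finset.mem_range] at hz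
        omega)).linRep
    have hZ : 2 ≤ (n + 2) ^ t := two_le_add_two_pow ht
    have hfilter : ((Finset.range (B.card + 1)).filter fun z => f z = true).card ≤
        ((n + 2) ^ t) ^ 1 := by
      rw [pow_one]
      refine (Finset.card_filter_le _ _).trans ?_
      rw [Finset.card_range]
      have := card_le B
      exact le_trans (by omega) (Nat.le_self_pow (by omega) (n + 2))
    convert h.mono le_rfl (mul_le_pow_add hfilter (one_add_one_add_le_pow hZ
      (mul_le_pow_add (le_pow_self_of_two_le hZ _)
        (mul_le_pow_add (le_pow_self_of_two_le hZ _) (modSize_le ht hm0))))) using 2 with x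
    rw [Finset.sum_filter, Finset.sum_eq_single (zeros B x)]
    · cases f (zeros B x) <;> simp
    · intro z _ hz
      simp [hz.symm]
    · intro hz
      exact absurd (Finset.mem_range.2 (Nat.lt_succ_of_le (zeros_le_card B x))) hz
  | succ k ih =>
    obtain ⟨c, ih⟩ := ih
    refine ⟨1 + norExp P.card m c, fun n t ht p hp B hB f => ?_⟩
    obtain ⟨q, hq, hne⟩ := P.exists_mem_ne (by omega) p
    obtain ⟨A, hA, hsum⟩ := exists_blocks t (t ^ (P.card + k)) B
      (hB.trans_eq (by rw [← add_assoc, pow_succ, mul_comm]))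
    have hzeros : ∀ x, zeros B x = ∑ j, zeros (A j) x := fun x => hsum _
    -- `v` runs over the guesses of the block counts at which `f` is true. Only the correct guess
    -- passes its NOR, so the sum is the value of `f`.
    have h := LinRep.sum (p := p) ((Finset.univ : Finset (Fin t → Fin (n + 1))).filter
      fun v => f (∑ j, (v j : ℕ)) = true) fun v _ =>
        LinRep.nor hP hm hp hq hne.symm (y := fun j x => decide (zeros (A j) x ≠ v j)) fun j =>
          ih n t ht q hq (A j) (hA j) fun z => decide (z ≠ v j)
    have hfilter : ((Finset.univ : Finset (Fin t → Fin (n + 1))).filter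
        fun v => f (∑ j, (v j : ℕ)) = true).card ≤ ((n + 2) ^ t) ^ 1 := by
      rw [pow_one]
      refine (Finset.card_filter_le _ _).trans ?_
      simpa using Nat.pow_le_pow_left (by omega) t
    convert h.mono le_rfl (mul_le_pow_add hfilter
      (norSize_le ht hm0 (Nat.le_mul_of_pos_left t hm0) le_rfl)) using 2 with x
    let v₀ : Fin t → Fin (n + 1) := fun j =>
      ⟨zeros (A j) x, Nat.lt_succ_of_le ((zeros_le_card _ x).trans (card_le _))⟩
    have hv : ∀ v : Fin t → Fin (n + 1),
        (∀ j, decide (zeros (A j) x ≠ v j) = false) ↔ v₀ = v := fun v => by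
      simp [funext_iff, v₀, Fin.ext_iff]
    simp only [hv]
    rw [Finset.sum_ite_eq, hzeros]
    simp only [Finset.mem_filter, Finset.mem_univ, true_and, v₀]
    cases f (∑ j, zeros (A j) x) <;> simp

theorem exists_comp_of_symmetric (hP : ∀ q ∈ P, q.Prime) (hm : m = ∏ q ∈ P, q)
    (hcard : 2 ≤ P.card) (k : ℕ) : ∃ c, ∀ n t : ℕ, 1 ≤ t → n ≤ t ^ (P.card + k) →
      ∀ f : (Fin n → Bool) → Bool, IsSymmetricFunction f →
        Comp m n (k + 3) (((n + 2) ^ t) ^ c) f := by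
  classical
  obtain ⟨c, hc⟩ := exists_linRep_zeros hP hm hcard k
  obtain ⟨p, hp⟩ : P.Nonempty := Finset.card_pos.1 (by omega)
  have : Fact p.Prime := ⟨hP p hp⟩
  refine ⟨P.card + (m + c) + 2, fun n t ht hn f hf => ?_⟩
  -- The negation of `f` as a function of the count, since the output gate returns `1` exactly when
  -- the combination vanishes.
  have h := (hc n t ht p hp Finset.univ (by simpa using hn) fun z =>
    decide (∀ x, zeros Finset.univ x = z → f x = false)).comp_eq_zero hP hm hp
  have hZ : 2 ≤ (n + 2) ^ t := two_le_add_two_pow ht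
  have hsize : 1 + P.card * (m * ((n + 2) ^ t) ^ c) ≤
      ((n + 2) ^ t) ^ (P.card + (m + c) + 2) :=
    le_trans (by omega) (one_add_one_add_le_pow hZ (mul_le_pow_add (le_pow_self_of_two_le hZ _)
      (mul_le_pow_add (le_pow_self_of_two_le hZ _) le_rfl)))
  obtain ⟨C, h1, h2, h3⟩ := h
  refine ⟨C, h1, fun x => ?_, h3.trans hsize⟩
  rw [h2 x]
  have hx : (∀ y, zeros Finset.univ y = zeros Finset.univ x → f y = false) ↔ f x = false := by
    refine ⟨fun h => h x rfl, fun h y hy => ?_⟩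
    rw [hf y x, h]
    have := sum_toNat_add_zeros x
    have := sum_toNat_add_zeros y
    omega
  simp only [hx]
  cases f x <;> simp

end ModCircuit

/-! ### Asymptotics and the choice of `t` -/

theorem isSoftO_root (e c : ℕ) (he : 0 < e) :
    IsSoftO (fun n => c * ((⌈(n : ℝ) ^ (1 / (e : ℝ))⌉₊ + 1 : ℕ) : ℝ) * Real.log ((n : ℝ) + 2))
      fun n => (n : ℝ) ^ (1 / (e : ℝ)) := by
  -- With `g = n ^ (1 / e)`: the factor `3` is from `⌈g⌉₊ + 1 ≤ 3 * g`, and `2 * e` from `log (n +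
  -- 2) ≤ 2 * log n = 2 * e * log g`.
  refine ⟨1, Asymptotics.IsBigO.of_bound (c * 3 * (2 * e)) ?_⟩
  filter_upwards [Filter.eventually_ge_atTop 2] with n hn
  have hn' : (2 : ℝ) ≤ n := by exact_mod_cast hn
  have he' : (0 : ℝ) < e := by exact_mod_cast he
  set g : ℝ := (n : ℝ) ^ (1 / (e : ℝ)) with hg
  have hg1 : 1 ≤ g := Real.one_le_rpow (by linarith) (by positivity)
  have hlog : Real.log n = e * Real.log g := by
    rw [hg, Real.log_rpow (by linarith)]
    field_simp
  have hlog2 : Real.log ((n : ℝ) + 2) ≤ 2 * e * Real.log g := by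
    have : Real.log ((n : ℝ) + 2) ≤ Real.log ((n : ℝ) ^ 2) :=
      Real.log_le_log (by linarith) (by nlinarith)
    rw [Real.log_pow, hlog] at this
    push_cast at this
    linarith
  have hlog0 : 0 ≤ Real.log ((n : ℝ) + 2) := Real.log_nonneg (by linarith)
  have hceil : ((⌈g⌉₊ + 1 : ℕ) : ℝ) ≤ 3 * g := by
    have := (Nat.ceil_lt_add_one (by linarith : 0 ≤ g)).le
    push_cast
    linarith
  have hgl : 0 ≤ Real.log g := Real.log_nonneg hg1
  rw [Real.norm_of_nonneg (by positivity), Real.norm_of_nonneg (by positivity), pow_one]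
  calc c * ((⌈g⌉₊ + 1 : ℕ) : ℝ) * Real.log ((n : ℝ) + 2)
      ≤ c * (3 * g) * (2 * e * Real.log g) := by gcongr
    _ = c * 3 * (2 * e) * (g * Real.log g) := by ring

/-- The base is the value used for `t`; its `+ 1` ensures `1 ≤ t` even for `n = 0`. -/
theorem le_ceil_root_pow {e : ℕ} (he : 0 < e) (n : ℕ) :
    n ≤ (⌈(n : ℝ) ^ (1 / (e : ℝ))⌉₊ + 1) ^ e := by
  have h : (n : ℝ) ≤ (((⌈(n : ℝ) ^ (1 / (e : ℝ))⌉₊ + 1) ^ e : ℕ) : ℝ) := by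
    calc (n : ℝ) = ((n : ℝ) ^ (1 / (e : ℝ))) ^ e := by
          rw [one_div, Real.rpow_inv_natCast_pow (Nat.cast_nonneg n) he.ne']
      _ ≤ (((⌈(n : ℝ) ^ (1 / (e : ℝ))⌉₊ + 1) ^ e : ℕ) : ℝ) := by
          push_cast
          gcongr
          exact (Nat.le_ceil _).trans (by linarith)
  exact_mod_cast h

theorem theorem2 (d : ℕ) (hd : 3 ≤ d) (r : ℕ) (hr : 2 ≤ r) (P : Finset ℕ)
    (hP : ∀ p ∈ P, p.Prime) (hcard : P.card = r) (m : ℕ) (hm : m = ∏ p ∈ P, p) :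
    ∃ s : ℕ → ℝ, IsSoftO s (fun n => (n : ℝ) ^ (1 / ((r : ℝ) + (d : ℝ) - 3))) ∧
      ∀ (n : ℕ) (f : (Fin n → Bool) → Bool), IsSymmetricFunction f →
        ∃ C : ModCircuit m n, C.depth ≤ d ∧ C.Computes f ∧ (C.size : ℝ) ≤ Real.exp (s n) := by
  subst hcard
  obtain ⟨k, rfl⟩ := Nat.exists_eq_add_of_le' hd
  have he : (P.card : ℝ) + ((k + 3 : ℕ) : ℝ) - 3 = ((P.card + k : ℕ) : ℝ) := by
    push_cast
    ring
  have hpos : 0 < P.card + k := by omega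
  rw [he]
  obtain ⟨c, hc⟩ := ModCircuit.exists_comp_of_symmetric hP hm hr k
  refine ⟨_, isSoftO_root (P.card + k) c hpos, fun n f hf => ?_⟩
  obtain ⟨C, h1, h2, h3⟩ := hc n _ (Nat.le_add_left 1 _) (le_ceil_root_pow hpos n) f hf
  refine ⟨C, h1, h2, ?_⟩
  have h4 : (C.size : ℝ) ≤
      (((n : ℝ) + 2) ^ (⌈(n : ℝ) ^ (1 / ((P.card + k : ℕ) : ℝ))⌉₊ + 1)) ^ c := by
    exact_mod_cast h3
  refine h4.trans_eq ?_
  rw [← pow_mul, mul_comm _ c, ← Nat.cast_mul, Real.exp_nat_mul,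
    Real.exp_log (by positivity)]
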